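/- Call a real square matrix nonnegative if all its entries are nonnegative, and a $Z$-matrix if all its off-diagonal entries are nonpositive (with no condition on the diagonal). A nonnegative matrix $B$ is called infinitely divisible if there is a sequence $(K_n)_{n\ge 1}$ of nonnegative matrices of the same size with $(K_n)^n = B$ for every integer $n\ge 1$; it is called strongly infinitely divisible if in addition $\det B > 0$. Theorem. Let $B$ be a nonnegative $N\times N$ matrix. Then $B$ is strongly infinitely divisible if and only if there exists a real $N\times N$ $Z$-matrix $Q$ such that $e^{-Q} = B$, where $e^{-Q}=\sum_{k\ge 0} (-Q)^k/k!$ is the matrix exponential. -/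

import Mathlib

/-- A real matrix is (entrywise) nonnegative. -/
def EntrywiseNonneg {N : ℕ} (B : Matrix (Fin N) (Fin N) ℝ) : Prop :=
  ∀ i j, 0 ≤ B i j

/-- `B` is infinitely divisible: it is nonnegative and there is a sequence `K₁, K₂, …` of
nonnegative matrices with `(Kₙ)ⁿ = B` for every `n ≥ 1` (the value `K 0` is irrelevant). -/
def InfinitelyDivisible {N : ℕ} (B : Matrix (Fin N) (Fin N) ℝ) : Prop :=
  EntrywiseNonneg B ∧
    ∃ K : ℕ → Matrix (Fin N) (Fin N) ℝ,
      ∀ n : ℕ, 1 ≤ n → EntrywiseNonneg (K n) ∧ (K n) ^ n = B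

/-- `B` is strongly infinitely divisible: infinitely divisible with positive determinant. -/
def StronglyInfinitelyDivisible {N : ℕ} (B : Matrix (Fin N) (Fin N) ℝ) : Prop :=
  InfinitelyDivisible B ∧ 0 < B.det

/-- A `Z`-matrix: a real square matrix whose off-diagonal entries are all nonpositive. -/
def IsZMatrix {N : ℕ} (Q : Matrix (Fin N) (Fin N) ℝ) : Prop :=
  ∀ i j, i ≠ j → Q i j ≤ 0

open Filter Topology

/-! If `Q` is a Z-matrix, adding a scalar matrix makes `-Q` nonnegative, so each `exp (-Q / n)` is a
nonnegative `n`-th root. Conversely, roots must be found that tend to `1` at rate `1 / n`. Arbitrary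
roots may permute coordinates, so put `r n = K (n * N!) ^ N!`: permutations of `Fin N` have trivial
`N!`-th power, and `det B > 0` then bounds below the diagonals of all `r n ^ l`, `l ≤ n`. These
powers thus lie in one compact set (`InfinitelyDivisible.exists_roots_mem_pinchedMatrices`). Only
`1` has all its powers in that set, so by compactness `r n ^ l` is near `1` for `l ≤ n / m`, with
`m` fixed. Hence `n * ‖r n - 1‖` is bounded; a limit point `g` of `n • (r n - 1)` has nonnegative
off-diagonal entries and `exp g = B`. -/

/-! ### Roots near the identity and their exponential limit -/

theorem norm_sub_one_mul_le {𝔸 : Type*} [NormedRing 𝔸] [NormedAlgebra ℝ 𝔸] (x : 𝔸) (m : ℕ)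
    (h : ∀ l ≤ m, ‖x ^ l - 1‖ ≤ 1 / 2) : (m : ℝ) * ‖x - 1‖ ≤ 1 := by
  -- The last term has norm at most half that of the left side, so it can be absorbed.
  have h1 : (m : ℝ) • (x - 1) =
      (x ^ m - 1) - (x - 1) * ∑ l ∈ Finset.range m, (x ^ l - 1) := by
    rw [Finset.sum_sub_distrib, mul_sub, mul_geom_sum]
    simp [Nat.cast_smul_eq_nsmul, nsmul_eq_mul, Nat.cast_comm]
  have h2 : ‖∑ l ∈ Finset.range m, (x ^ l - 1)‖ ≤ m * (1 / 2) := by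
    refine (norm_sum_le_of_le _ fun l hl => h l (Finset.mem_range.1 hl).le).trans ?_
    simp
  have h3 : (m : ℝ) * ‖x - 1‖ = ‖(m : ℝ) • (x - 1)‖ := by rw [norm_smul]; simp
  have h4 : ‖(m : ℝ) • (x - 1)‖ ≤ 1 / 2 + ‖x - 1‖ * (m * (1 / 2)) := by
    rw [h1]
    refine (norm_sub_le _ _).trans (add_le_add (h m le_rfl) ((norm_mul_le _ _).trans ?_))
    gcongr
  nlinarith

theorem norm_pow_sub_pow_le {𝔸 : Type*} [NormedRing 𝔸] {x y : 𝔸} (hxy : Commute x y) (n : ℕ)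
    {a b : ℝ} (hx : ∀ l ≤ n, ‖x ^ l‖ ≤ a) (hy : ∀ l ≤ n, ‖y ^ l‖ ≤ b) :
    ‖x ^ n - y ^ n‖ ≤ a * b * (n * ‖x - y‖) := by
  have ha : 0 ≤ a := (norm_nonneg _).trans (hx 0 (Nat.zero_le _))
  rw [← hxy.mul_geom_sum₂]
  have h2 : ‖∑ i ∈ Finset.range n, x ^ i * y ^ (n - 1 - i)‖ ≤ n * (a * b) := by
    refine (norm_sum_le_of_le (f := fun i => x ^ i * y ^ (n - 1 - i)) (n := fun _ => a * b) _
      fun l hl => ?_).trans ?_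
    · have := Finset.mem_range.1 hl
      refine (norm_mul_le _ _).trans ?_
      exact mul_le_mul (hx _ this.le) (hy _ (by omega)) (norm_nonneg _) ha
    · simp
  calc _ ≤ ‖x - y‖ * _ := norm_mul_le _ _
    _ ≤ ‖x - y‖ * (n * (a * b)) := by gcongr
    _ = _ := by ring

theorem exists_exp_eq_of_pow_eq {𝔸 : Type*} [NormedRing 𝔸] [NormedAlgebra ℝ 𝔸] [ProperSpace 𝔸]
    {r : ℕ → 𝔸} {b : 𝔸} {C c : ℝ} (hr : ∀ n, 1 ≤ n → r n ^ n = b)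
    (hC : ∀ n, ∀ l ≤ n, ‖r n ^ l‖ ≤ C) (hc : ∀ n : ℕ, (n : ℝ) * ‖r n - 1‖ ≤ c) :
    ∃ (g : 𝔸) (φ : ℕ → ℕ), StrictMono φ ∧
      Tendsto (fun k => (φ k : ℝ) • (r (φ k) - 1)) atTop (𝓝 g) ∧ NormedSpace.exp g = b := by
  let _ : NormedAlgebra ℚ 𝔸 := NormedAlgebra.restrictScalars ℚ ℝ 𝔸
  obtain ⟨g, -, φ, hφ, hg⟩ := (isCompact_closedBall (0 : 𝔸) c).tendsto_subseq
    (x := fun n => (n : ℝ) • (r n - 1)) fun n => by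
      simpa [norm_smul] using hc n
  refine ⟨g, φ, hφ, hg, ?_⟩
  have hexp : Tendsto (fun k => NormedSpace.exp ((φ k : ℝ) • (r (φ k) - 1))) atTop
      (𝓝 (NormedSpace.exp g)) := (NormedSpace.exp_continuous.tendsto g).comp hg
  refine tendsto_nhds_unique hexp ?_
  have hc0 : 0 ≤ c := by simpa using hc 0
  have hφ' : Tendsto (fun k => (φ k : ℝ)) atTop atTop :=
    tendsto_natCast_atTop_atTop.comp hφ.tendsto_atTop
  have hr1 : Tendsto (fun k => r (φ k) - 1) atTop (𝓝 0) := by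
    refine squeeze_zero_norm' (a := fun k => c * (φ k : ℝ)⁻¹) ?_ ?_
    · filter_upwards [hφ'.eventually_gt_atTop 0] with k hk
      rw [← div_eq_mul_inv, le_div_iff₀ hk, mul_comm]
      exact hc _
    · simpa using hφ'.inv_tendsto_atTop.const_mul c
  obtain ⟨E, hE⟩ : ∃ E, ∀ x : 𝔸, ‖x‖ ≤ c → ‖NormedSpace.exp x‖ ≤ E := by
    obtain ⟨E, hE⟩ := (isCompact_closedBall (0 : 𝔸) c).exists_bound_of_continuousOn
      (NormedSpace.exp_continuous (𝔸 := 𝔸)).continuousOn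
    exact ⟨E, fun x hx => hE x (by simpa using hx)⟩
  -- `exp h = 1 + h + o(h)` at `h = r n - 1`, where `n * ‖h‖ ≤ c`.
  have hlit : Tendsto (fun k => (φ k : ℝ) * ‖r (φ k) - NormedSpace.exp (r (φ k) - 1)‖) atTop
      (𝓝 0) := by
    have h0 := (hasFDerivAt_exp_zero (𝕂 := ℝ) (𝔸 := 𝔸)).isLittleO
    have h1 := (h0.comp_tendsto hr1).norm_norm
    have h2 := (Asymptotics.isBigO_refl (fun k => (φ k : ℝ)) atTop).mul_isLittleO h1
    have h3 : (fun k => (φ k : ℝ) * ‖((fun x' => x' - 0) ∘ fun k => r (φ k) - 1) k‖)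
        =O[atTop] (fun _ => (1 : ℝ)) := by
      refine Asymptotics.IsBigO.of_bound c (Eventually.of_forall fun k => ?_)
      simpa using hc (φ k)
    have h4 := (h2.trans_isBigO h3).tendsto_div_nhds_zero
    refine h4.congr fun k => ?_
    simp only [Function.comp, div_one, NormedSpace.exp_zero, sub_zero]
    rw [norm_sub_rev (r (φ k))]
    congr 2
    simp
  rw [tendsto_iff_norm_sub_tendsto_zero]
  refine squeeze_zero' (Eventually.of_forall fun _ => norm_nonneg _)
    (g := fun k => C * E * ((φ k : ℝ) * ‖r (φ k) - NormedSpace.exp (r (φ k) - 1)‖)) ?_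
    (by simpa using hlit.const_mul (C * E))
  filter_upwards [hφ.tendsto_atTop.eventually_ge_atTop 1] with k hk
  rw [norm_sub_rev]
  conv_lhs => rw [← hr (φ k) hk, Nat.cast_smul_eq_nsmul, NormedSpace.exp_nsmul]
  refine norm_pow_sub_pow_le ?_ _ (hC _) fun l hl => ?_
  · exact ((Commute.refl (r (φ k))).sub_right (Commute.one_right _)).exp_right
  · rw [← NormedSpace.exp_nsmul]
    refine hE _ ?_
    rw [← Nat.cast_smul_eq_nsmul ℝ, norm_smul, Real.norm_natCast]
    exact (mul_le_mul_of_nonneg_right (by exact_mod_cast hl) (norm_nonneg _)).trans (hc (φ k))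

open scoped Matrix.Norms.Operator in
theorem Matrix.abs_apply_le_norm {N : ℕ} (A : Matrix (Fin N) (Fin N) ℝ) (i j : Fin N) :
    |A i j| ≤ ‖A‖ := by
  rw [Matrix.linfty_opNorm_def]
  refine le_trans ?_ (NNReal.coe_le_coe.2 (Finset.le_sup (f := fun i => ∑ j, ‖A i j‖₊)
    (Finset.mem_univ i)))
  refine le_trans ?_ (NNReal.coe_le_coe.2 (Finset.single_le_sum (f := fun j => ‖A i j‖₊)
    (fun _ _ => zero_le) (Finset.mem_univ j)))
  simp

open scoped Matrix.Norms.Operator in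
theorem Matrix.norm_le_of_abs_apply_le {N : ℕ} {A : Matrix (Fin N) (Fin N) ℝ} {ε : ℝ} (hε : 0 ≤ ε)
    (h : ∀ i j, |A i j| ≤ ε) : ‖A‖ ≤ N * ε := by
  lift ε to NNReal using hε
  rw [Matrix.linfty_opNorm_def, ← NNReal.coe_natCast, ← NNReal.coe_mul, NNReal.coe_le_coe]
  refine Finset.sup_le fun i _ => (Finset.sum_le_card_nsmul _ _ ε fun j _ => ?_).trans ?_
  · exact NNReal.coe_le_coe.1 (by simpa using h i j)
  · simp

-- The norm serves only the proof: the limit is entrywise and `exp` refers to the entrywise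
-- topology, so the result does not depend on the norm.
open scoped Matrix.Norms.Operator in
theorem Matrix.exists_exp_eq_of_pow_eq {N : ℕ}
    {r : ℕ → Matrix (Fin N) (Fin N) ℝ} {b : Matrix (Fin N) (Fin N) ℝ} {C c : ℝ}
    (hr : ∀ n, 1 ≤ n → r n ^ n = b)
    (hC : ∀ n, ∀ l ≤ n, ‖r n ^ l‖ ≤ C) (hc : ∀ n : ℕ, (n : ℝ) * ‖r n - 1‖ ≤ c) :
    ∃ (g : Matrix (Fin N) (Fin N) ℝ) (φ : ℕ → ℕ), StrictMono φ ∧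
      (∀ i j, Tendsto (fun k => (φ k : ℝ) * (r (φ k) - 1) i j) atTop (𝓝 (g i j))) ∧
      @NormedSpace.exp _ _ instTopologicalSpaceMatrix _ g = b := by
  have : ProperSpace (Matrix (Fin N) (Fin N) ℝ) := FiniteDimensional.proper ℝ _
  obtain ⟨g, φ, hφ, hg, hb⟩ := _root_.exists_exp_eq_of_pow_eq hr hC hc
  refine ⟨g, φ, hφ, fun i j => ?_, hb⟩
  rw [tendsto_iff_norm_sub_tendsto_zero] at hg ⊢
  refine squeeze_zero (fun _ => norm_nonneg _) (fun k => ?_) hg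
  exact Matrix.abs_apply_le_norm ((φ k : ℝ) • (r (φ k) - 1) - g) i j

/-! ### Nonnegative matrices and exponentials of Z-matrices -/

theorem EntrywiseNonneg.one {N : ℕ} : EntrywiseNonneg (1 : Matrix (Fin N) (Fin N) ℝ) := by
  intro i j
  rw [Matrix.one_apply]
  split_ifs <;> norm_num

theorem EntrywiseNonneg.mul {N : ℕ} {A B : Matrix (Fin N) (Fin N) ℝ} (hA : EntrywiseNonneg A)
    (hB : EntrywiseNonneg B) : EntrywiseNonneg (A * B) := fun i j => by
  rw [Matrix.mul_apply]
  exact Finset.sum_nonneg fun k _ => mul_nonneg (hA i k) (hB k j)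

theorem EntrywiseNonneg.pow {N : ℕ} {A : Matrix (Fin N) (Fin N) ℝ} (hA : EntrywiseNonneg A)
    (n : ℕ) : EntrywiseNonneg (A ^ n) := by
  induction n with
  | zero => simpa using EntrywiseNonneg.one
  | succ n ih => rw [pow_succ]; exact ih.mul hA

theorem EntrywiseNonneg.mul_apply_le {N : ℕ} {A B : Matrix (Fin N) (Fin N) ℝ}
    (hA : EntrywiseNonneg A) (hB : EntrywiseNonneg B) (i k j : Fin N) :
    A i k * B k j ≤ (A * B) i j := by
  rw [Matrix.mul_apply]
  exact Finset.single_le_sum (f := fun k => A i k * B k j)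
    (fun k _ => mul_nonneg (hA i k) (hB k j)) (Finset.mem_univ k)

theorem EntrywiseNonneg.pow_apply_le {N : ℕ} {A : Matrix (Fin N) (Fin N) ℝ}
    (hA : EntrywiseNonneg A) (i : Fin N) (n : ℕ) : A i i ^ n ≤ (A ^ n) i i := by
  induction n with
  | zero => simp
  | succ n ih =>
    rw [pow_succ, pow_succ]
    exact (mul_le_mul_of_nonneg_right ih (hA i i)).trans ((hA.pow n).mul_apply_le hA i i i)

theorem EntrywiseNonneg.exp {N : ℕ} {A : Matrix (Fin N) (Fin N) ℝ} (hA : EntrywiseNonneg A) :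
    EntrywiseNonneg (NormedSpace.exp A) := by
  intro i j
  rw [NormedSpace.exp_eq_tsum ℝ]
  by_cases hs : Summable fun n : ℕ => ((n.factorial : ℝ)⁻¹ • A ^ n)
  · have h1 := Pi.hasSum.1 (Pi.hasSum.1 hs.hasSum i) j
    exact h1.nonneg fun n => mul_nonneg (by positivity) (hA.pow n i j)
  · simp [tsum_eq_zero_of_not_summable hs]

theorem EntrywiseNonneg.exp_of_offDiag {N : ℕ} {A : Matrix (Fin N) (Fin N) ℝ}
    (hA : ∀ i j, i ≠ j → 0 ≤ A i j) : EntrywiseNonneg (NormedSpace.exp A) := by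
  let c := ∑ i, |A i i|
  have hc : ∀ i, |A i i| ≤ c := fun i =>
    Finset.single_le_sum (f := fun i => |A i i|) (fun i _ => abs_nonneg _) (Finset.mem_univ i)
  have h1 : A = (A + Matrix.diagonal fun _ => c) + Matrix.diagonal fun _ => -c := by
    ext i j
    by_cases hij : i = j <;> simp [hij]
  have hcomm : Commute (A + Matrix.diagonal fun _ => c) (Matrix.diagonal fun _ => -c) := by
    have : (Matrix.diagonal fun _ : Fin N => -c) = Matrix.scalar (Fin N) (-c) := rfl
    rw [this]
    exact (Matrix.scalar_commute _ (fun r => Commute.all _ _) _).symm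
  rw [h1, Matrix.exp_add_of_commute _ _ hcomm, Matrix.exp_diagonal]
  refine EntrywiseNonneg.mul (EntrywiseNonneg.exp fun i j => ?_) fun i j => ?_
  · by_cases hij : i = j
    · subst hij
      simpa using by linarith [neg_abs_le (A i i), hc i]
    · simpa [hij] using hA i j hij
  · rw [Matrix.diagonal_apply]
    split_ifs
    · rw [Pi.exp_def, ← Real.exp_eq_exp_ℝ]
      exact (Real.exp_pos _).le
    · exact le_rfl

theorem exp_inv_smul_pow {N : ℕ} (A : Matrix (Fin N) (Fin N) ℝ) {n : ℕ} (hn : 1 ≤ n) :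
    NormedSpace.exp ((n : ℝ)⁻¹ • A) ^ n = NormedSpace.exp A := by
  have hn' : (n : ℝ) ≠ 0 := by positivity
  rw [← Matrix.exp_nsmul, ← Nat.cast_smul_eq_nsmul ℝ, smul_smul, mul_inv_cancel₀ hn', one_smul]

/-- `exp A` is the square of the invertible matrix `exp (A / 2)`. -/
theorem det_exp_pos {N : ℕ} (A : Matrix (Fin N) (Fin N) ℝ) :
    0 < Matrix.det (NormedSpace.exp A) := by
  have hne : ∀ X : Matrix (Fin N) (Fin N) ℝ, Matrix.det (NormedSpace.exp X) ≠ 0 := fun X => by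
    have hu : IsUnit (NormedSpace.exp X) := Matrix.isUnit_exp X
    exact ((Matrix.isUnit_iff_isUnit_det _).1 hu).ne_zero
  rw [← exp_inv_smul_pow A one_le_two, Matrix.det_pow]
  exact even_two.pow_pos (hne _)

theorem IsZMatrix.stronglyInfinitelyDivisible_exp_neg {N : ℕ} {Q : Matrix (Fin N) (Fin N) ℝ}
    (hQ : IsZMatrix Q) : StronglyInfinitelyDivisible (NormedSpace.exp (-Q)) := by
  have hnn : ∀ t : ℝ, 0 ≤ t → EntrywiseNonneg (NormedSpace.exp (t • -Q)) := fun t ht =>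
    EntrywiseNonneg.exp_of_offDiag fun i j hij => by
      simpa using mul_nonpos_of_nonneg_of_nonpos ht (hQ i j hij)
  refine ⟨⟨?_, fun n => NormedSpace.exp ((n : ℝ)⁻¹ • -Q), fun n hn => ⟨?_, ?_⟩⟩, det_exp_pos _⟩
  · have := hnn 1 zero_le_one
    rwa [one_smul] at this
  · exact hnn _ (by positivity)
  · exact exp_inv_smul_pow _ hn

/-! ### Compactness forces small powers of the roots towards the identity -/

/-- Nonnegative matrices with entries at most `C`, diagonal entries at least `δ`, and determinant
at least `β` in absolute value. -/
def pinchedMatrices (N : ℕ) (C δ β : ℝ) : Set (Matrix (Fin N) (Fin N) ℝ) :=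
  {A | EntrywiseNonneg A ∧ (∀ i j, A i j ≤ C) ∧ (∀ i, δ ≤ A i i) ∧ β ≤ |A.det|}

theorem isClosed_pinchedMatrices (N : ℕ) (C δ β : ℝ) : IsClosed (pinchedMatrices N C δ β) := by
  have hc : ∀ i j, Continuous fun A : Matrix (Fin N) (Fin N) ℝ => A i j := fun i j =>
    continuous_id.matrix_elem i j
  simp only [pinchedMatrices, EntrywiseNonneg, Set.ofPred_and, Set.ofPred_forall]
  refine IsClosed.inter ?_ (IsClosed.inter ?_ (IsClosed.inter ?_ ?_))
  · exact isClosed_iInter fun i => isClosed_iInter fun j => isClosed_le continuous_const (hc i j)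
  · exact isClosed_iInter fun i => isClosed_iInter fun j => isClosed_le (hc i j) continuous_const
  · exact isClosed_iInter fun i => isClosed_le continuous_const (hc i i)
  · exact isClosed_le continuous_const continuous_id.matrix_det.abs

theorem isCompact_pinchedMatrices (N : ℕ) (C δ β : ℝ) : IsCompact (pinchedMatrices N C δ β) := by
  have h : IsCompact (Set.univ.pi fun _ : Fin N => Set.univ.pi fun _ : Fin N => Set.Icc 0 C) :=
    isCompact_univ_pi fun _ => isCompact_univ_pi fun _ => isCompact_Icc
  exact h.of_isClosed_subset (isClosed_pinchedMatrices N C δ β)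
    fun A hA i _ j _ => ⟨hA.1 i j, hA.2.1 i j⟩

theorem exists_subseq_tendsto_of_mem_pinchedMatrices {N : ℕ} {C δ β : ℝ}
    {x : ℕ → Matrix (Fin N) (Fin N) ℝ} (hx : ∀ n, x n ∈ pinchedMatrices N C δ β) :
    ∃ A ∈ pinchedMatrices N C δ β, ∃ φ : ℕ → ℕ, StrictMono φ ∧ Tendsto (x ∘ φ) atTop (𝓝 A) :=
  have : FirstCountableTopology (Matrix (Fin N) (Fin N) ℝ) :=
    inferInstanceAs (FirstCountableTopology (Fin N → Fin N → ℝ))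
  (isCompact_pinchedMatrices N C δ β).tendsto_subseq hx

theorem eq_one_of_forall_pow_mem_Icc {a δ C : ℝ} (hδ : 0 < δ) (h : ∀ k : ℕ, a ^ k ∈ Set.Icc δ C) :
    a = 1 := by
  rcases lt_trichotomy a 1 with h1 | h1 | h1
  · obtain ⟨k, hk⟩ := exists_pow_lt_of_lt_one hδ h1
    exact absurd (h k).1 hk.not_ge
  · exact h1
  · obtain ⟨k, hk⟩ := pow_unbounded_of_one_lt C h1
    exact absurd (h k).2 hk.not_ge

/-- Along a convergent subsequence of powers, `adj (A ^ p) * A ^ q` tends to the diagonal matrix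
`adj L * L`. For `p < q` it equals `det (A ^ p) • A ^ (q - p)`, whose `(i, j)` entry is at least `β
* A i j * δ` in absolute value; so `A` is diagonal, with diagonal entries whose powers stay in `[δ,
C]`. -/
theorem eq_one_of_forall_pow_mem_pinchedMatrices {N : ℕ} {C δ β : ℝ} (hδ : 0 < δ) (hβ : 0 < β)
    {A : Matrix (Fin N) (Fin N) ℝ} (hA : ∀ k : ℕ, A ^ k ∈ pinchedMatrices N C δ β) : A = 1 := by
  have hA0 : EntrywiseNonneg A := by simpa using (hA 1).1
  have hoff : ∀ i j, i ≠ j → A i j = 0 := by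
    intro i j hij
    obtain ⟨L, -, φ, hφ, hL⟩ := exists_subseq_tendsto_of_mem_pinchedMatrices hA
    have hL' : Tendsto (fun k => A ^ φ (k + 1)) atTop (𝓝 L) := hL.comp (tendsto_add_atTop_nat 1)
    have h1 : Tendsto (fun k => (A ^ φ k).adjugate * A ^ φ (k + 1)) atTop
        (𝓝 (L.adjugate * L)) :=
      (((continuous_id.matrix_adjugate).tendsto L).comp hL).mul hL'
    have h2 : Tendsto (fun k => |((A ^ φ k).adjugate * A ^ φ (k + 1)) i j|) atTop (𝓝 0) := by
      have := (((continuous_id.matrix_elem i j).tendsto _).comp h1).abs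
      simpa [Matrix.adjugate_mul, hij, Function.comp_def] using this
    have h3 : β * (A i j * δ) ≤ 0 := by
      refine ge_of_tendsto' h2 fun k => ?_
      have hlt : φ k < φ (k + 1) := hφ (Nat.lt_succ_self k)
      have e : φ (k + 1) = φ k + (1 + (φ (k + 1) - φ k - 1)) := by omega
      have h5 := hA (1 + (φ (k + 1) - φ k - 1))
      rw [e, pow_add, ← mul_assoc (A ^ φ k).adjugate, Matrix.adjugate_mul, Matrix.smul_mul, one_mul,
        Matrix.smul_apply, smul_eq_mul, abs_mul, abs_of_nonneg (h5.1 i j)]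
      refine mul_le_mul (hA _).2.2.2 ?_ (mul_nonneg (hA0 i j) hδ.le) (abs_nonneg _)
      rw [pow_add, pow_one]
      exact (mul_le_mul_of_nonneg_left ((hA _).2.2.1 j) (hA0 i j)).trans
        (hA0.mul_apply_le (hA _).1 i j j)
    have h6 : A i j * δ ≤ 0 := nonpos_of_mul_nonpos_right h3 hβ
    exact le_antisymm (nonpos_of_mul_nonpos_left h6 hδ) (hA0 i j)
  have hdiag : A = Matrix.diagonal fun i => A i i := by
    ext i j
    by_cases hij : i = j
    · simp [hij]
    · simp [hij, hoff i j hij]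
  ext i j
  by_cases hij : i = j
  · subst hij
    rw [Matrix.one_apply_eq]
    refine eq_one_of_forall_pow_mem_Icc (C := C) hδ fun k => ?_
    have : (A ^ k) i i = A i i ^ k := by
      conv_lhs => rw [hdiag, Matrix.diagonal_pow]
      simp
    rw [← this]
    exact ⟨(hA k).2.2.1 i, (hA k).2.1 i i⟩
  · rw [hoff i j hij, Matrix.one_apply_ne hij]

theorem exists_forall_pow_close_one {N : ℕ} {C δ β ε : ℝ} (hδ : 0 < δ) (hβ : 0 < β) (hε : 0 < ε)
    {r : ℕ → Matrix (Fin N) (Fin N) ℝ}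
    (hr : ∀ n, ∀ l ≤ n, r n ^ l ∈ pinchedMatrices N C δ β) :
    ∃ m : ℕ, 1 ≤ m ∧ ∀ n l, l * m ≤ n → ∀ i j, |(r n ^ l - 1) i j| ≤ ε := by
  by_contra! hcon
  choose n l hln i j hij using fun m : ℕ => hcon (m + 1) (Nat.le_add_left 1 m)
  -- The `m`-th counterexample has its first `m + 1` powers in the set, so a limit point has all of
  -- them there.
  have hmem : ∀ m k, k ≤ m + 1 → (r (n m) ^ l m) ^ k ∈ pinchedMatrices N C δ β := fun m k hk => by
    rw [← pow_mul]
    exact hr _ _ ((Nat.mul_le_mul_left _ hk).trans (hln m))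
  obtain ⟨A, -, φ, hφ, hA⟩ := exists_subseq_tendsto_of_mem_pinchedMatrices
    (x := fun m => r (n m) ^ l m) fun m => by simpa using hmem m 1 (Nat.le_add_left 1 m)
  have hA1 : A = 1 := eq_one_of_forall_pow_mem_pinchedMatrices hδ hβ (C := C) fun k => by
    refine (isClosed_pinchedMatrices N C δ β).mem_of_tendsto (hA.pow k) ?_
    filter_upwards [eventually_ge_atTop k] with m hm
    exact hmem _ _ ((hm.trans (hφ.id_le m)).trans (Nat.le_succ _))
  subst hA1
  have h0 : ∀ p : Fin N × Fin N, ∀ᶠ m in atTop,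
      |(r (n (φ m)) ^ l (φ m) - 1) p.1 p.2| < ε := fun p => by
    have h1 := ((continuous_id.matrix_elem p.1 p.2).tendsto _).comp (hA.sub_const 1)
    have h2 := h1.abs
    simp only [sub_self, id, Matrix.zero_apply, abs_zero] at h2
    exact h2.eventually_lt_const hε
  obtain ⟨m, hm⟩ := (eventually_all.2 h0).exists
  exact (hij (φ m)).not_gt (hm (i (φ m), j (φ m)))

/-! ### Diagonal bounds from the determinant -/

theorem EntrywiseNonneg.prod_le_pow_apply {N : ℕ} {A : Matrix (Fin N) (Fin N) ℝ}
    (hA : EntrywiseNonneg A) (σ : Equiv.Perm (Fin N)) (i : Fin N) (n : ℕ) :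
    ∏ k ∈ Finset.range n, A ((σ ^ (k + 1)) i) ((σ ^ k) i) ≤ (A ^ n) ((σ ^ n) i) i := by
  induction n with
  | zero => simp
  | succ n ih =>
    rw [Finset.prod_range_succ, pow_succ' A, mul_comm]
    exact (mul_le_mul_of_nonneg_left ih (hA _ _)).trans (hA.mul_apply_le (hA.pow n) _ _ _)

theorem EntrywiseNonneg.exists_perm_le_prod {N : ℕ} {A : Matrix (Fin N) (Fin N) ℝ}
    (hA : EntrywiseNonneg A) : ∃ σ : Equiv.Perm (Fin N), |A.det| ≤ N.factorial * ∏ i, A (σ i) i := by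
  have h : |A.det| ≤ ∑ σ : Equiv.Perm (Fin N), ∏ i, A (σ i) i := by
    rw [Matrix.det_apply']
    refine (Finset.abs_sum_le_sum_abs _ _).trans (Finset.sum_le_sum fun σ _ => ?_)
    rw [abs_mul, abs_of_nonneg (Finset.prod_nonneg fun i _ => hA (σ i) i)]
    rcases Int.units_eq_one_or (Equiv.Perm.sign σ) with h | h <;> simp [h]
  obtain ⟨σ, -, hσ⟩ := Finset.exists_max_image (Finset.univ : Finset (Equiv.Perm (Fin N)))
    (fun σ => ∏ i, A (σ i) i) Finset.univ_nonempty
  refine ⟨σ, h.trans ((Finset.sum_le_card_nsmul _ _ _ hσ).trans ?_)⟩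
  simp [Fintype.card_perm]

/-- Some `σ` has `∏ j, A (σ j) j ≥ β / N!`. Following `σ` for `N!` steps gives closed walks of
weight `g j ≤ (A ^ N!) j j`, with `∏ j, g j` the `N!`-th power of that product; each factor other
than `g i` is at most `c`. -/
theorem EntrywiseNonneg.le_pow_factorial_apply {N : ℕ} {A : Matrix (Fin N) (Fin N) ℝ} {β c : ℝ}
    (hA : EntrywiseNonneg A) (hβ : 0 ≤ β) (hdet : β ≤ |A.det|) (hc : 1 ≤ c)
    (hAc : ∀ i, (A ^ N.factorial) i i ≤ c) (i : Fin N) :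
    (β / N.factorial) ^ N.factorial / c ^ N ≤ (A ^ N.factorial) i i := by
  obtain ⟨σ, hσ⟩ := hA.exists_perm_le_prod
  have hM : (0 : ℝ) < N.factorial := by exact_mod_cast N.factorial_pos
  have hσ1 : σ ^ N.factorial = 1 := by
    have := pow_card_eq_one' (x := σ)
    rwa [Nat.card_eq_fintype_card, Fintype.card_perm, Fintype.card_fin] at this
  let g : Fin N → ℝ := fun j =>
    ∏ k ∈ Finset.range N.factorial, A ((σ ^ (k + 1)) j) ((σ ^ k) j)
  have hg0 : ∀ j, 0 ≤ g j := fun j => Finset.prod_nonneg fun k _ => hA _ _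
  have hg : ∀ j, g j ≤ (A ^ N.factorial) j j := fun j => by
    simpa [hσ1] using hA.prod_le_pow_apply σ j N.factorial
  have hprod : ∏ j, g j = (∏ j, A (σ j) j) ^ N.factorial := by
    simp only [g]
    rw [Finset.prod_comm]
    rw [Finset.prod_congr rfl (g := fun _ => ∏ j, A (σ j) j) fun k _ => ?_]
    · simp
    · rw [← Equiv.prod_comp (σ ^ k) fun j => A (σ j) j]
      simp [pow_succ']
  refine le_trans ?_ (hg i)
  rw [div_le_iff₀ (by positivity)]
  calc (β / N.factorial) ^ N.factorial ≤ (∏ j, A (σ j) j) ^ N.factorial := by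
        refine pow_le_pow_left₀ (by positivity) ?_ _
        rw [div_le_iff₀' hM]
        exact hdet.trans hσ
    _ = ∏ j, g j := hprod.symm
    _ = g i * ∏ j ∈ Finset.univ.erase i, g j := (Finset.mul_prod_erase _ _ (Finset.mem_univ i)).symm
    _ ≤ g i * c ^ N := by
        refine mul_le_mul_of_nonneg_left ?_ (hg0 i)
        refine (Finset.prod_le_prod (fun j _ => hg0 j) fun j _ => (hg j).trans (hAc j)).trans ?_
        rw [Finset.prod_const]
        exact pow_le_pow_right₀ hc ((Finset.card_le_univ _).trans (by simp))

open scoped Matrix.Norms.Operator in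
theorem pow_apply_self_le {N : ℕ} (B : Matrix (Fin N) (Fin N) ℝ) (i : Fin N) (l : ℕ) :
    (B ^ l) i i ≤ max 1 ‖B‖ ^ l := by
  rcases Nat.eq_zero_or_pos l with rfl | hl
  · simp
  · calc (B ^ l) i i ≤ |(B ^ l) i i| := le_abs_self _
      _ ≤ ‖B ^ l‖ := Matrix.abs_apply_le_norm _ i i
      _ ≤ ‖B‖ ^ l := norm_pow_le' B hl
      _ ≤ _ := pow_le_pow_left₀ (norm_nonneg _) (le_max_right _ _) _

theorem EntrywiseNonneg.pow_apply_self_le_of_pow_eq {N : ℕ} {R B : Matrix (Fin N) (Fin N) ℝ} {c : ℝ}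
    (hR : EntrywiseNonneg R) {n l : ℕ} (hn : n ≠ 0) (hRB : R ^ n = B) (hc : 1 ≤ c)
    (hB : ∀ i l, (B ^ l) i i ≤ c ^ l) (hl : l ≤ n) (i : Fin N) : (R ^ l) i i ≤ c := by
  refine le_of_pow_le_pow_left₀ hn (by linarith) ?_
  calc (R ^ l) i i ^ n ≤ ((R ^ l) ^ n) i i := (hR.pow l).pow_apply_le i n
    _ = (B ^ l) i i := by rw [pow_right_comm, hRB]
    _ ≤ c ^ l := hB i l
    _ ≤ c ^ n := pow_le_pow_right₀ hc hl

theorem min_one_det_le_abs_det_pow {N : ℕ} {R B : Matrix (Fin N) (Fin N) ℝ} {n l : ℕ} (hn : n ≠ 0)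
    (hRB : R ^ n = B) (hB : 0 < B.det) (hl : l ≤ n) : min 1 B.det ≤ |(R ^ l).det| := by
  have h0 : 0 ≤ min 1 B.det := le_min zero_le_one hB.le
  refine le_of_pow_le_pow_left₀ hn (abs_nonneg _) ?_
  calc min 1 B.det ^ n ≤ min 1 B.det ^ l := pow_le_pow_of_le_one h0 (min_le_left _ _) hl
    _ ≤ B.det ^ l := pow_le_pow_left₀ h0 (min_le_right _ _) _
    _ = |(R ^ l).det| ^ n := by
      rw [← abs_pow, ← Matrix.det_pow (R ^ l), pow_right_comm, hRB, Matrix.det_pow,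
        abs_of_pos (pow_pos hB l)]

/-! ### Choice of roots and the generator -/

theorem InfinitelyDivisible.exists_roots_mem_pinchedMatrices {N : ℕ}
    {B : Matrix (Fin N) (Fin N) ℝ} (hB : InfinitelyDivisible B) (hdet : 0 < B.det) :
    ∃ (r : ℕ → Matrix (Fin N) (Fin N) ℝ) (C δ β : ℝ), 0 < δ ∧ 0 < β ∧
      (∀ n, 1 ≤ n → r n ^ n = B) ∧ ∀ n, ∀ l ≤ n, r n ^ l ∈ pinchedMatrices N C δ β := by
  obtain ⟨hB0, K, hK⟩ := hB
  obtain ⟨c, hc, hBc⟩ : ∃ c : ℝ, 1 ≤ c ∧ ∀ i l, (B ^ l) i i ≤ c ^ l :=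
    open scoped Matrix.Norms.Operator in ⟨max 1 ‖B‖, le_max_left _ _, pow_apply_self_le B⟩
  set M := N.factorial
  have hMpos : 0 < M := N.factorial_pos
  have hdM : ∀ n, 1 ≤ n → 1 ≤ n * M := fun n hn => Nat.mul_pos hn hMpos
  have hβ : 0 < min 1 B.det := lt_min one_pos hdet
  set β := min 1 B.det
  let δ := (β / M) ^ M / c ^ N
  have hδ : 0 < δ := by positivity
  have hroot : ∀ n, 1 ≤ n → (K (n * M) ^ M) ^ n = B := fun n hn => by
    rw [← pow_mul, mul_comm M]
    exact (hK _ (hdM n hn)).2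
  have hdiag : ∀ n l, 1 ≤ n → l ≤ n → ∀ i, δ ≤ ((K (n * M) ^ M) ^ l) i i := fun n l hn hl i => by
    have hL := (hK _ (hdM n hn)).1.pow l
    rw [pow_right_comm]
    refine hL.le_pow_factorial_apply hβ.le ?_ hc (fun j => ?_) i
    · exact min_one_det_le_abs_det_pow (Nat.pos_iff_ne_zero.1 (hdM n hn)) (hK _ (hdM n hn)).2 hdet
        (hl.trans (Nat.le_mul_of_pos_right n hMpos))
    · rw [pow_right_comm]
      exact ((hK _ (hdM n hn)).1.pow M).pow_apply_self_le_of_pow_eq (by omega) (hroot n hn) hc hBc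
        hl j
  have hBsum : ∀ i j, B i j ≤ ∑ i, ∑ j, B i j := fun i j =>
    (Finset.single_le_sum (f := fun j => B i j) (fun j _ => hB0 i j) (Finset.mem_univ j)).trans
      (Finset.single_le_sum (f := fun i => ∑ j, B i j)
        (fun i _ => Finset.sum_nonneg fun j _ => hB0 i j) (Finset.mem_univ i))
  have hmem : ∀ n l, 1 ≤ n → l ≤ n →
      (K (n * M) ^ M) ^ l ∈ pinchedMatrices N ((∑ i, ∑ j, B i j) / δ) δ β := fun n l hn hl => by
    have hR := (hK _ (hdM n hn)).1.pow M
    refine ⟨hR.pow l, fun i j => ?_, hdiag n l hn hl, ?_⟩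
    -- From `B = R ^ l * R ^ (n - l)`: the second factor has diagonal at least `δ`, so an entry of
    -- `R ^ l` times `δ` is at most an entry of `B`.
    · rw [le_div_iff₀ hδ]
      have h1 := (hR.pow l).mul_apply_le (hR.pow (n - l)) i j j
      rw [← pow_add, Nat.add_sub_cancel' hl, hroot n hn] at h1
      exact (mul_le_mul_of_nonneg_left (hdiag n (n - l) hn (Nat.sub_le _ _) j)
        (hR.pow l i j)).trans (h1.trans (hBsum i j))
    · exact min_one_det_le_abs_det_pow (by omega) (hroot n hn) hdet hl
  refine ⟨fun n => K (n * M) ^ M, (∑ i, ∑ j, B i j) / δ, δ, β, hδ, hβ, hroot, fun n l hl => ?_⟩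
  rcases Nat.eq_zero_or_pos n with rfl | hn
  -- `K 0` is uncontrolled, but only its zeroth power occurs here.
  · obtain rfl := Nat.le_zero.1 hl
    simpa using hmem 1 0 le_rfl zero_le_one
  · exact hmem n l hn hl

open scoped Matrix.Norms.Operator in
theorem StronglyInfinitelyDivisible.exists_exp_neg_eq {N : ℕ} {B : Matrix (Fin N) (Fin N) ℝ}
    (hB : StronglyInfinitelyDivisible B) :
    ∃ Q : Matrix (Fin N) (Fin N) ℝ, IsZMatrix Q ∧
      @NormedSpace.exp _ _ instTopologicalSpaceMatrix _ (-Q) = B := by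
  obtain ⟨r, C, δ, β, hδ, hβ, hroot, hmem⟩ := hB.1.exists_roots_mem_pinchedMatrices hB.2
  obtain ⟨m, hm, hclose⟩ := exists_forall_pow_close_one hδ hβ
    -- Makes `N * ε ≤ 1 / 2` in the operator norm; `N + 1` keeps `ε` meaningful when `N = 0`.
    (ε := 1 / (2 * (N + 1))) (by positivity) hmem
  have hnorm : ∀ n l, l * m ≤ n → ‖r n ^ l - 1‖ ≤ 1 / 2 := fun n l hl => by
    refine (Matrix.norm_le_of_abs_apply_le (by positivity) (hclose n l hl)).trans ?_
    rw [mul_one_div, div_le_div_iff₀ (by positivity) (by positivity)]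
    linarith
  have hC : ∀ n, ∀ l ≤ n, ‖r n ^ l‖ ≤ N * |C| := fun n l hl =>
    Matrix.norm_le_of_abs_apply_le (abs_nonneg C) fun i j => by
      rw [abs_of_nonneg ((hmem n l hl).1 i j)]
      exact ((hmem n l hl).2.1 i j).trans (le_abs_self C)
  obtain ⟨D, hD⟩ : ∃ D, ∀ n, 1 ≤ n → ‖r n - 1‖ ≤ D :=
    ⟨N * |C| + ‖(1 : Matrix (Fin N) (Fin N) ℝ)‖, fun n hn =>
      (norm_sub_le _ _).trans (add_le_add (by simpa using hC n 1 hn) le_rfl)⟩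
  have hlin : ∀ n : ℕ, (n : ℝ) * ‖r n - 1‖ ≤ m + m * |D| := fun n => by
    rcases Nat.eq_zero_or_pos n with rfl | hn
    · simpa using by positivity
    have h1 : ((n / m : ℕ) : ℝ) * ‖r n - 1‖ ≤ 1 :=
      norm_sub_one_mul_le _ _ fun l hl => hnorm n l
        ((Nat.mul_le_mul_right m hl).trans (Nat.div_mul_le_self n m))
    have h2 : (n : ℝ) ≤ m * (n / m : ℕ) + m := by
      exact_mod_cast (Nat.div_add_mod n m).symm.le.trans
        (Nat.add_le_add_left (Nat.mod_lt n hm).le _)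
    have h3 : (0 : ℝ) ≤ m := Nat.cast_nonneg m
    calc (n : ℝ) * ‖r n - 1‖ ≤ (m * (n / m : ℕ) + m) * ‖r n - 1‖ := by gcongr
      _ = m * (((n / m : ℕ) : ℝ) * ‖r n - 1‖) + m * ‖r n - 1‖ := by ring
      _ ≤ m * 1 + m * |D| := by gcongr; exact (hD n hn).trans (le_abs_self D)
      _ = _ := by ring
  obtain ⟨g, φ, hφ, hg, hexp⟩ := Matrix.exists_exp_eq_of_pow_eq hroot hC hlin
  refine ⟨-g, fun i j hij => ?_, by rw [neg_neg]; exact hexp⟩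
  rw [Matrix.neg_apply, neg_nonpos]
  refine ge_of_tendsto' (hg i j) fun k => ?_
  rcases Nat.eq_zero_or_pos (φ k) with h | h
  · simp [h]
  · have h1 := (hmem (φ k) 1 h).1 i j
    rw [pow_one] at h1
    simpa [hij] using mul_nonneg (Nat.cast_nonneg _) h1

theorem theorem1 (N : ℕ) (B : Matrix (Fin N) (Fin N) ℝ) (hB : EntrywiseNonneg B) :
    StronglyInfinitelyDivisible B ↔
      ∃ Q : Matrix (Fin N) (Fin N) ℝ, IsZMatrix Q ∧ NormedSpace.exp (-Q) = B := by
  refine ⟨fun h => h.exists_exp_neg_eq, ?_⟩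
  rintro ⟨Q, hQ, rfl⟩
  exact hQ.stronglyInfinitelyDivisible_exp_neg
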